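/- Let $a,b,\eta,c,\rho>0$ and $\delta>1$, and let $f$ be a probability density of claim sizes, carried by $(0,\infty)$. Let $(\Omega,\mathcal F,\mathbb P)$ be a probability space carrying, for every $y\ge b$, a filtration $\mathbb F$ (complete and right-continuous) and a Hawkes claim process with initial intensity $y$: a counting process $N$ (with $N_0=0$ and unit jumps) and i.i.d. positive claim sizes $(Y_k)_{k\ge1}$ with density $f$, independent of $N$, such that $N$ and $\sum_{k\le N_t}Y_k$ are $\mathbb F$-adapted and the marked point process $(N,(Y_k))$ has $\mathbb F$-compensator $\lambda_t\,dt\,f(z)\,dz$, where $$d\lambda_t=a(b-\lambda_t)\,dt+\eta\,dN_t,\qquad \lambda_0=y .$$ (All these objects may depend on $y$.) For $x\in\mathbb R$ put $R_t=x+ct-\sum_{k=1}^{N_t}Y_k$. A strategy $\alpha=(Z,K)$ consists of $\mathbb F$-adapted non-decreasing processes, $Z$ (cumulative dividends) right-continuous with left limits and $Z_{0-}=0$, and $K$ (cumulative capital injections) left-continuous with right limits and $K_0=K_{0-}=0$. The controlled surplus is $X_t=R_t-Z_t+K_t$, with $X_{0-}=R_{0-}=x$. The strategy is admissible, $\alpha\in\mathcal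 A(x,y)$, if $Z_t-Z_{t-}\le (X_{t-}+R_t-R_{t-})^+$ for all $t\ge0$. The ruin time is $T^\alpha=\inf\{t\ge0: X_{t+}<0\}$ (with $\inf\emptyset=\infty$), and $$J_\alpha(x,y)=\mathbb E\Big[\int_{[0,T^\alpha]}e^{-\rho s}\,dZ_s-\delta\int_{[0,T^\alpha]}e^{-\rho s}\,dK_s\Big],\qquad v(x,y)=\sup_{\alpha\in\mathcal A(x,y)}J_\alpha(x,y),$$ where jumps at times $0$ and $T^\alpha$ are included (the jump of $K$ at $s$ being $K_{s+}-K_s$), and $J_\alpha(x,y)=-\infty$ if the expected discounted injections are infinite. Then, for every $x\ge0$, $$\lim_{y\to+\infty}v(x,y)=x .$$ -/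

import Mathlib

open MeasureTheory ProbabilityTheory Filter Topology
open scoped NNReal ENNReal

noncomputable section

namespace DividendHawkes

/-- Extension of a path on `[0, ∞)` to the real line by its value `0` at negative times;
this encodes the convention that the process is `0` at time `0-`. -/
def extendPath (G : ℝ≥0 → ℝ) (t : ℝ) : ℝ := if t < 0 then 0 else G t.toNNReal

lemma extendPath_mono {G : ℝ≥0 → ℝ} (hG : Monotone G) (h0 : 0 ≤ G 0) :
    Monotone (extendPath G) := by
  intro s t hst
  unfold extendPath
  split_ifs with hs ht ht
  · exact le_rfl
  · exact h0.trans (hG bot_le)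
  · exact absurd (hst.trans_lt ht) hs
  · exact hG (Real.toNNReal_le_toNNReal hst)

/-- The Lebesgue-Stieltjes measure `dG` on the line of a non-decreasing path `G` with `G_{0-} = 0`.
It charges `{t}` with the total jump `G_{t+} - G_{t-}`, in particular `{0}` with `G_{0+}`. -/
def pathMeasure (G : ℝ≥0 → ℝ) (hG : Monotone G) (h0 : 0 ≤ G 0) : Measure ℝ :=
  (extendPath_mono hG h0).stieltjesFunction.measure

/-- The law on the line of a claim size with density `f`. -/
def claimLaw (f : ℝ → ℝ) : Measure ℝ := volume.withDensity fun z => ENNReal.ofReal (f z)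

section

variable {Ω : Type*}

/-- The time of the claim number `k + 1` of the counting process `N` (meaningful when there is
such a claim). -/
def claimTime (N : ℝ≥0 → Ω → ℕ) (k : ℕ) (ω : Ω) : ℝ≥0 := sInf {t | k < N t ω}

open Classical in
/-- The sum of `H (τ_k, Y_k)` over all claims, for a non-negative random field `H`; the sequence
`Y` is indexed from `0`, so that `Y k` is the size of the claim number `k + 1`. -/
def sumOverClaims (N : ℝ≥0 → Ω → ℕ) (Y : ℕ → Ω → ℝ) (H : (ℝ≥0 × Ω) × ℝ → ℝ≥0∞) (ω : Ω) : ℝ≥0∞ :=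
  ∑' k : ℕ, if ∃ t, k < N t ω then H ((claimTime N k ω, ω), Y k ω) else 0

end

/-- A Hawkes claim process with parameters `a, b, η`, initial intensity `y` and claim-size
density `f`, on the probability space `(Ω, P)`, with a filtration satisfying the usual conditions.
The last field is the definition of "the claim process has `𝔽`-intensity `λ` and claim sizes
of density `f`": the `𝔽`-compensator of the marked point process is `λ_s ds f(z) dz`. -/
structure HawkesClaims {Ω : Type*} [mΩ : MeasurableSpace Ω] (P : Measure Ω)
    (a b η : ℝ) (f : ℝ → ℝ) (y : ℝ) where
  /-- the filtration, right-continuous and complete -/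
  𝔽 : Filtration ℝ≥0 mΩ
  rightContinuous : 𝔽.IsRightContinuous
  complete : ∀ t (s : Set Ω), P s = 0 → MeasurableSet[𝔽 t] s
  /-- the number of claims up to time `t` -/
  N : ℝ≥0 → Ω → ℕ
  /-- the claim sizes -/
  Y : ℕ → Ω → ℝ
  /-- the intensity of the claims -/
  lam : ℝ≥0 → Ω → ℝ
  N_zero : ∀ ω, N 0 ω = 0
  N_mono : ∀ ω, Monotone fun t => N t ω
  N_rightCont : ∀ ω t, ContinuousWithinAt (fun s => N s ω) (Set.Ici t) t
  /-- claims occur one at a time: `N_t ≤ N_{t-} + 1` -/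
  N_jump : ∀ ω t, 0 < t → ∃ s < t, N t ω ≤ N s ω + 1
  N_adapted : Adapted 𝔽 N
  Y_measurable : ∀ k, Measurable (Y k)
  Y_pos : ∀ k, ∀ᵐ ω ∂P, 0 < Y k ω
  Y_law : ∀ k, P.map (Y k) = claimLaw f
  Y_indep : iIndepFun Y P
  Y_indep_N : IndepFun (fun ω k => Y k ω) (fun ω t => N t ω) P
  /-- a claim size is known once the claim has occurred -/
  claims_adapted : Adapted 𝔽 fun t ω => ∑ k ∈ Finset.range (N t ω), Y k ω
  lam_intervalIntegrable : ∀ ω (t : ℝ≥0),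
    IntervalIntegrable (fun s : ℝ => lam s.toNNReal ω) volume 0 t
  /-- `dλ_t = a (b - λ_t) dt + η dN_t` with `λ_0 = y` -/
  lam_eq : ∀ ω (t : ℝ≥0),
    lam t ω = y + (∫ s in (0 : ℝ)..t, a * (b - lam s.toNNReal ω)) + η * N t ω
  intensity : ∀ H : (ℝ≥0 × Ω) × ℝ → ℝ≥0∞,
    Measurable[MeasurableSpace.prod 𝔽.predictable (borel ℝ)] H →
    ∫⁻ ω, sumOverClaims N Y H ω ∂P =
      ∫⁻ ω, (∫⁻ s in Set.Ioi (0 : ℝ), (∫⁻ z, H ((s.toNNReal, ω), z) ∂claimLaw f) *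
        ENNReal.ofReal (lam s.toNNReal ω)) ∂P

/-- A pair of cumulative dividends `Z` (adapted, non-decreasing, right-continuous, `Z_{0-} = 0`)
and cumulative capital injections `K` (adapted, non-decreasing, left-continuous,
`K_0 = K_{0-} = 0`; a capital injection at time `0` is the jump `K_{0+} - K_0`). -/
structure Strategy {Ω : Type*} [mΩ : MeasurableSpace Ω] (𝔽 : Filtration ℝ≥0 mΩ) where
  Z : ℝ≥0 → Ω → ℝ
  K : ℝ≥0 → Ω → ℝ
  Z_adapted : Adapted 𝔽 Z
  Z_mono : ∀ ω, Monotone fun t => Z t ω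
  Z_rightCont : ∀ ω t, ContinuousWithinAt (fun s => Z s ω) (Set.Ici t) t
  Z_zero : ∀ ω, 0 ≤ Z 0 ω
  K_adapted : Adapted 𝔽 K
  K_mono : ∀ ω, Monotone fun t => K t ω
  K_leftCont : ∀ ω t, ContinuousWithinAt (fun s => K s ω) (Set.Iic t) t
  K_zero : ∀ ω, K 0 ω = 0

section

variable {Ω : Type*} [mΩ : MeasurableSpace Ω] {P : Measure Ω} {a b η : ℝ} {f : ℝ → ℝ} {y : ℝ}

/-- The uncontrolled reserve `R^x_t = x + c t - ∑_{k ≤ N_t} Y_k`. -/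
def reserve (M : HawkesClaims P a b η f y) (c x : ℝ) (t : ℝ≥0) (ω : Ω) : ℝ :=
  x + c * t - ∑ k ∈ Finset.range (M.N t ω), M.Y k ω

/-- The controlled surplus `X_t = R^x_t - Z_t + K_t`. -/
def surplus (M : HawkesClaims P a b η f y) (c x : ℝ) (α : Strategy M.𝔽) (t : ℝ≥0) (ω : Ω) : ℝ :=
  reserve M c x t ω - α.Z t ω + α.K t ω

/-- Dividends cannot exceed the available reserve:
`Z_t - Z_{t-} ≤ (X_{t-} + R_t - R_{t-})^+`, which at `t = 0`, where `Z_{0-} = 0` and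
`X_{0-} = x`, reads `Z_0 ≤ x^+`. -/
def IsAdmissible (M : HawkesClaims P a b η f y) (c x : ℝ) (α : Strategy M.𝔽) : Prop :=
  ∀ ω, α.Z 0 ω ≤ max x 0 ∧
    ∀ t, 0 < t →
      α.Z t ω - Function.leftLim (fun s => α.Z s ω) t ≤
        max (Function.leftLim (fun s => surplus M c x α s ω) t +
          (reserve M c x t ω - Function.leftLim (fun s => reserve M c x s ω) t)) 0

/-- The ruin time `T = inf {t ≥ 0 : X_{t+} < 0}`, equal to `∞` if there is no such `t`. -/
def ruinTime (M : HawkesClaims P a b η f y) (c x : ℝ) (α : Strategy M.𝔽) (ω : Ω) : ℝ≥0∞ :=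
  ⨅ (t : ℝ≥0) (_ : Function.rightLim (fun s => surplus M c x α s ω) t < 0), (t : ℝ≥0∞)

/-- The times `0 ≤ s ≤ T`. -/
def untilRuin (M : HawkesClaims P a b η f y) (c x : ℝ) (α : Strategy M.𝔽) (ω : Ω) : Set ℝ :=
  {s | 0 ≤ s ∧ ENNReal.ofReal s ≤ ruinTime M c x α ω}

/-- `E [∫_{[0, T]} e^{-ρ s} dZ_s]`. -/
def expectedDividends (M : HawkesClaims P a b η f y) (c ρ x : ℝ) (α : Strategy M.𝔽) : ℝ≥0∞ :=
  ∫⁻ ω, (∫⁻ s in untilRuin M c x α ω, ENNReal.ofReal (Real.exp (-ρ * s))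
    ∂pathMeasure (fun t => α.Z t ω) (α.Z_mono ω) (α.Z_zero ω)) ∂P

/-- `E [∫_{[0, T]} e^{-ρ s} dK_s]`. -/
def expectedInjections (M : HawkesClaims P a b η f y) (c ρ x : ℝ) (α : Strategy M.𝔽) : ℝ≥0∞ :=
  ∫⁻ ω, (∫⁻ s in untilRuin M c x α ω, ENNReal.ofReal (Real.exp (-ρ * s))
    ∂pathMeasure (fun t => α.K t ω) (α.K_mono ω) (α.K_zero ω).ge) ∂P

/-- The expected discounted dividends minus `δ` times the expected discounted injections. It is an
extended real, equal to `-∞` when the expected cost of the injections is infinite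
(in `EReal`, `⊤ - ⊤ = ⊥`). -/
def reward (M : HawkesClaims P a b η f y) (c ρ δ x : ℝ) (α : Strategy M.𝔽) : EReal :=
  (expectedDividends M c ρ x α : EReal) - (δ : EReal) * (expectedInjections M c ρ x α : EReal)

/-- The value function: the supremum of the reward over all admissible strategies. -/
def value (M : HawkesClaims P a b η f y) (c ρ δ x : ℝ) : EReal :=
  ⨆ (α : Strategy M.𝔽) (_ : IsAdmissible M c x α), reward M c ρ δ x α

end

end DividendHawkes

end

namespace DividendHawkes

lemma lintegral_exp_neg_Ioi {ρ : ℝ} (hρ : 0 < ρ) (s : ℝ) :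
    ∫⁻ t in Set.Ioi s, ENNReal.ofReal (ρ * Real.exp (-ρ * t)) =
      ENNReal.ofReal (Real.exp (-ρ * s)) := by
  have hint := integrableOn_exp_mul_Ioi (neg_lt_zero.mpr hρ) s
  rw [← ofReal_integral_eq_lintegral_ofReal (hint.const_mul ρ)
    (ae_of_all _ fun t => by positivity), integral_const_mul,
    integral_exp_mul_Ioi (neg_lt_zero.mpr hρ)]
  congr 1
  field_simp

/-- Layer-cake formula for the exponentially discounted mass of a measure. -/
lemma lintegral_discount {ρ : ℝ} (hρ : 0 < ρ) (μ : Measure ℝ) [SFinite μ] {A : Set ℝ}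
    (hA : MeasurableSet A) (hA0 : A ⊆ Set.Ici 0) :
    ∫⁻ s in A, ENNReal.ofReal (Real.exp (-ρ * s)) ∂μ =
      ∫⁻ t in Set.Ioi (0 : ℝ), ENNReal.ofReal (ρ * Real.exp (-ρ * t)) * μ (A ∩ Set.Iic t) := by
  have hmeas : Measurable fun p : ℝ × ℝ => ENNReal.ofReal (ρ * Real.exp (-ρ * p.2)) *
      {p : ℝ × ℝ | p.1 ≤ p.2}.indicator 1 p :=
    (by fun_prop : Measurable fun p : ℝ × ℝ => ENNReal.ofReal (ρ * Real.exp (-ρ * p.2))).mul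
      (measurable_one.indicator (measurableSet_le measurable_fst measurable_snd))
  calc ∫⁻ s in A, ENNReal.ofReal (Real.exp (-ρ * s)) ∂μ
      = ∫⁻ s in A, (∫⁻ t in Set.Ioi (0 : ℝ), ENNReal.ofReal (ρ * Real.exp (-ρ * t)) *
          {p : ℝ × ℝ | p.1 ≤ p.2}.indicator 1 (s, t)) ∂μ := by
        refine setLIntegral_congr_fun hA fun s hs => ?_
        have hs0 : (0 : ℝ) ≤ s := hA0 hs
        have h1 : (fun t => ENNReal.ofReal (ρ * Real.exp (-ρ * t)) *
            {p : ℝ × ℝ | p.1 ≤ p.2}.indicator (1 : ℝ × ℝ → ℝ≥0∞) (s, t)) =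
            (Set.Ici s).indicator fun t => ENNReal.ofReal (ρ * Real.exp (-ρ * t)) := by
          ext t
          by_cases h : s ≤ t <;> simp [h]
        simp only [h1]
        rw [setLIntegral_indicator measurableSet_Ici, ← lintegral_exp_neg_Ioi hρ s]
        refine setLIntegral_congr ?_
        have h2 : (Set.Ici s ∩ Set.Ici (0 : ℝ) : Set ℝ) = Set.Ici s :=
          Set.inter_eq_left.mpr fun t ht => hs0.trans ht
        have h3 : (Set.Ici s ∩ Set.Ioi (0 : ℝ) : Set ℝ) =ᵐ[volume] Set.Ici s := by
          conv_rhs => rw [← h2]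
          exact (ae_eq_refl _).inter Ioi_ae_eq_Ici
        exact Ioi_ae_eq_Ici.trans h3.symm
    _ = ∫⁻ t in Set.Ioi (0 : ℝ), (∫⁻ s in A, ENNReal.ofReal (ρ * Real.exp (-ρ * t)) *
          {p : ℝ × ℝ | p.1 ≤ p.2}.indicator 1 (s, t) ∂μ) :=
        lintegral_lintegral_swap hmeas.aemeasurable
    _ = _ := by
        refine lintegral_congr fun t => ?_
        rw [lintegral_const_mul _ (by
          exact (measurable_one.indicator (measurableSet_le measurable_fst measurable_snd)).comp
            (measurable_id.prodMk measurable_const))]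
        congr 1
        have h1 : (fun s => {p : ℝ × ℝ | p.1 ≤ p.2}.indicator (1 : ℝ × ℝ → ℝ≥0∞) (s, t)) =
            (Set.Iic t).indicator 1 := by
          ext s
          by_cases h : s ≤ t <;> simp [h]
        rw [h1, lintegral_indicator_one measurableSet_Iic,
          Measure.restrict_apply measurableSet_Iic, Set.inter_comm]

lemma lintegral_exp_neg_mul_id {ρ : ℝ} (hρ : 0 < ρ) :
    ∫⁻ t in Set.Ioi (0 : ℝ), ENNReal.ofReal (ρ * Real.exp (-ρ * t)) * ENNReal.ofReal t =
      ENNReal.ofReal (1 / ρ) := by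
  have h := lintegral_discount hρ volume (A := Set.Ici 0) measurableSet_Ici le_rfl
  have h2 : ∀ t : ℝ, volume (Set.Ici (0 : ℝ) ∩ Set.Iic t) = ENNReal.ofReal t := fun t => by
    rw [Set.Ici_inter_Iic, Real.volume_Icc, sub_zero]
  simp only [h2] at h
  rw [← h, ← setLIntegral_congr Ioi_ae_eq_Ici]
  have h3 := lintegral_exp_neg_Ioi hρ 0
  simp only [ENNReal.ofReal_mul hρ.le] at h3
  rw [lintegral_const_mul _ (by fun_prop), mul_zero, Real.exp_zero, ENNReal.ofReal_one] at h3
  rw [one_div, ENNReal.ofReal_inv_of_pos hρ]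
  exact ENNReal.eq_inv_of_mul_eq_one_left (by rwa [mul_comm] at h3)

section Path

variable {G : ℝ≥0 → ℝ}

instance (hG : Monotone G) (h0 : 0 ≤ G 0) : SFinite (pathMeasure G hG h0) := by
  unfold pathMeasure
  infer_instance

@[simp]
lemma extendPath_coe (t : ℝ≥0) : extendPath G t = G t := by
  simp [extendPath]

lemma rightLim_extendPath_of_neg {t : ℝ} (ht : t < 0) :
    Function.rightLim (extendPath G) t = 0 := by
  refine rightLim_eq_of_tendsto ?_
  refine tendsto_const_nhds.congr' ?_
  filter_upwards [nhdsWithin_le_nhds (Iio_mem_nhds ht)] with s hs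
  simp [extendPath, Set.mem_Iio.mp hs]

lemma tendsto_rightLim_extendPath (hG : Monotone G) (h0 : 0 ≤ G 0) (t : ℝ≥0) :
    Tendsto G (𝓝[>] t) (𝓝 (Function.rightLim (extendPath G) t)) := by
  have h1 := (extendPath_mono hG h0).tendsto_rightLim t
  have h2 : Tendsto ((↑) : ℝ≥0 → ℝ) (𝓝[>] t) (𝓝[>] (t : ℝ)) :=
    tendsto_nhdsWithin_of_tendsto_nhds_of_eventually_within _
      (NNReal.continuous_coe.continuousAt.mono_left nhdsWithin_le_nhds)
      (eventually_mem_nhdsWithin.mono fun s hs => NNReal.coe_lt_coe.mpr hs)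
  exact (h1.comp h2).congr fun s => extendPath_coe s

lemma rightLim_extendPath_of_continuous (hG : Monotone G) (h0 : 0 ≤ G 0) {t : ℝ≥0}
    (hc : ContinuousWithinAt G (Set.Ici t) t) :
    Function.rightLim (extendPath G) t = G t :=
  tendsto_nhds_unique (tendsto_rightLim_extendPath hG h0 t)
    (hc.tendsto.mono_left (nhdsWithin_mono _ Set.Ioi_subset_Ici_self))

lemma le_rightLim_extendPath (hG : Monotone G) (h0 : 0 ≤ G 0) (t : ℝ≥0) :
    G t ≤ Function.rightLim (extendPath G) t := by
  simpa using (extendPath_mono hG h0).le_rightLim (le_refl (t : ℝ))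

lemma rightLim_extendPath_le (hG : Monotone G) (h0 : 0 ≤ G 0) {s t : ℝ≥0} (hst : s < t) :
    Function.rightLim (extendPath G) s ≤ G t := by
  simpa using (extendPath_mono hG h0).rightLim_le (NNReal.coe_lt_coe.mpr hst)

lemma pathMeasure_Icc (hG : Monotone G) (h0 : 0 ≤ G 0) (r : ℝ) :
    pathMeasure G hG h0 (Set.Icc 0 r) =
      ENNReal.ofReal (Function.rightLim (extendPath G) r) := by
  rw [pathMeasure, StieltjesFunction.measure_Icc, leftLim_eq_of_tendsto (y := 0) ?_,
    sub_zero, Monotone.stieltjesFunction_eq]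
  refine tendsto_const_nhds.congr' ?_
  filter_upwards [self_mem_nhdsWithin] with s hs
  rw [Monotone.stieltjesFunction_eq, rightLim_extendPath_of_neg hs]

end Path

section Pathwise

variable {Ω : Type*} [mΩ : MeasurableSpace Ω] {P : Measure Ω} {a b η : ℝ} {f : ℝ → ℝ} {y : ℝ}
  (M : HawkesClaims P a b η f y) {c x : ℝ}

/-- The total capital injected up to and including time `t`, `K_{t+}`. -/
noncomputable def injected (α : Strategy M.𝔽) (t : ℝ) (ω : Ω) : ℝ :=
  Function.rightLim (extendPath fun s => α.K s ω) t

lemma tendsto_reserve_nhdsGT (c x : ℝ) (t : ℝ≥0) (ω : Ω) :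
    Tendsto (fun s => reserve M c x s ω) (𝓝[>] t) (𝓝 (reserve M c x t ω)) := by
  have hN : ∀ᶠ s in 𝓝[>] t, M.N s ω = M.N t ω := by
    have h := ((M.N_rightCont ω t).tendsto.mono_left
      (nhdsWithin_mono t Set.Ioi_subset_Ici_self))
    rw [nhds_discrete] at h
    exact tendsto_pure.mp h
  have hlin : Tendsto (fun s : ℝ≥0 => x + c * (s : ℝ) - ∑ k ∈ Finset.range (M.N t ω), M.Y k ω)
      (𝓝[>] t) (𝓝 (reserve M c x t ω)) := by
    refine (Continuous.tendsto ?_ t).mono_left nhdsWithin_le_nhds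
    fun_prop
  refine hlin.congr' ?_
  filter_upwards [hN] with s hs
  simp only [reserve, hs]

lemma exists_tendsto_reserve_nhdsLT (c x : ℝ) (t : ℝ≥0) (ω : Ω) :
    ∃ n, (∀ u < t, M.N u ω ≤ n) ∧ Tendsto (fun s => reserve M c x s ω) (𝓝[<] t)
      (𝓝 (x + c * t - ∑ k ∈ Finset.range n, M.Y k ω)) := by
  have hb : ∀ u < t, M.N u ω ≤ M.N t ω := fun u hu => M.N_mono ω hu.le
  refine ⟨sSup ((fun s => M.N s ω) '' Set.Iio t), fun u hu => le_csSup ⟨M.N t ω, ?_⟩ ⟨u, hu, rfl⟩,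
    ?_⟩
  · rintro _ ⟨u, hu, rfl⟩
    exact hb u hu
  · have h := (M.N_mono ω).tendsto_nhdsLT t
    rw [nhds_discrete] at h
    set n := sSup ((fun s => M.N s ω) '' Set.Iio t)
    have hlin : Tendsto (fun s : ℝ≥0 => x + c * (s : ℝ) - ∑ k ∈ Finset.range n, M.Y k ω)
        (𝓝[<] t) (𝓝 (x + c * t - ∑ k ∈ Finset.range n, M.Y k ω)) := by
      refine (Continuous.tendsto ?_ t).mono_left nhdsWithin_le_nhds
      fun_prop
    refine hlin.congr' ?_
    filter_upwards [tendsto_pure.mp h] with s hs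
    simp only [reserve, hs]

variable (α : Strategy M.𝔽) {ω : Ω}

lemma dividends_le_of_lt_ruinTime {t : ℝ≥0} (ht : (t : ℝ≥0∞) < ruinTime M c x α ω) :
    α.Z t ω ≤ reserve M c x t ω + injected M α t ω := by
  have h0 : ¬ Function.rightLim (fun s => surplus M c x α s ω) t < 0 := fun h =>
    absurd ht (not_lt.mpr (iInf₂_le (f := fun (t : ℝ≥0)
      (_ : Function.rightLim (fun s => surplus M c x α s ω) t < 0) => (t : ℝ≥0∞)) t h))
  have hZ : Tendsto (fun s => α.Z s ω) (𝓝[>] t) (𝓝 (α.Z t ω)) :=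
    (α.Z_rightCont ω t).tendsto.mono_left (nhdsWithin_mono _ Set.Ioi_subset_Ici_self)
  have hlim : Tendsto (fun s => surplus M c x α s ω) (𝓝[>] t)
      (𝓝 (reserve M c x t ω - α.Z t ω + injected M α t ω)) :=
    ((tendsto_reserve_nhdsGT M c x t ω).sub hZ).add
      (tendsto_rightLim_extendPath (α.K_mono ω) (α.K_zero ω).ge t)
  rw [rightLim_eq_of_tendsto hlim] at h0
  linarith

/-- Up to ruin, the dividends do not exceed the initial surplus, the premiums and the injections,
net of all claims that occurred strictly before. -/
lemma dividends_add_claims_le (hx : 0 ≤ x) (hα : IsAdmissible M c x α) {r : ℝ≥0}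
    (hr : (r : ℝ≥0∞) ≤ ruinTime M c x α ω) :
    ∃ n, (∀ u < r, M.N u ω ≤ n) ∧
      α.Z r ω + ∑ k ∈ Finset.range n, M.Y k ω ≤ x + c * r + injected M α r ω := by
  have hK : α.K r ω ≤ injected M α r ω :=
    le_rightLim_extendPath (α.K_mono ω) (α.K_zero ω).ge r
  rcases eq_or_ne r 0 with rfl | hr0
  · have h1 := (hα ω).1
    rw [max_eq_left hx] at h1
    rw [α.K_zero] at hK
    refine ⟨0, by simp, ?_⟩
    simp only [Finset.range_zero, Finset.sum_empty, NNReal.coe_zero] at hK ⊢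
    linarith
  have hrpos : 0 < r := pos_iff_ne_zero.mpr hr0
  have : (𝓝[<] r).NeBot := nhdsLT_neBot_of_exists_lt ⟨0, hrpos⟩
  obtain ⟨n, hn, hlim⟩ := exists_tendsto_reserve_nhdsLT M c x r ω
  have hZlim := (α.Z_mono ω).tendsto_leftLim r
  have hKlim : Tendsto (fun s => α.K s ω) (𝓝[<] r) (𝓝 (α.K r ω)) :=
    (α.K_leftCont ω r).tendsto.mono_left (nhdsWithin_mono _ Set.Iio_subset_Iic_self)
  have hXlim := leftLim_eq_of_tendsto ((hlim.sub hZlim).add hKlim)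
  have hadm := (hα ω).2 r hrpos
  rw [leftLim_eq_of_tendsto hlim] at hadm
  have hXlim' : Function.leftLim (fun s => surplus M c x α s ω) r = _ := hXlim
  rw [hXlim'] at hadm
  rcases le_max_iff.mp hadm with h | h
  · refine ⟨M.N r ω, fun u hu => M.N_mono ω hu.le, ?_⟩
    simp only [reserve] at h
    linarith
  · refine ⟨n, hn, ?_⟩
    have hle : Function.leftLim (fun s => α.Z s ω) r ≤
        x + c * r - ∑ k ∈ Finset.range n, M.Y k ω + α.K r ω := by
      refine le_of_tendsto_of_tendsto hZlim (hlim.add tendsto_const_nhds) ?_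
      filter_upwards [self_mem_nhdsWithin] with s hs
      have h1 := dividends_le_of_lt_ruinTime M α
        ((ENNReal.coe_lt_coe.mpr (Set.mem_Iio.mp hs)).trans_le hr)
      have h2 : injected M α s ω ≤ α.K r ω :=
        rightLim_extendPath_le (α.K_mono ω) (α.K_zero ω).ge hs
      linarith
    linarith

lemma untilRuin_inter_Iic (t : ℝ≥0) :
    ∃ r : ℝ≥0, (r : ℝ≥0∞) = min (t : ℝ≥0∞) (ruinTime M c x α ω) ∧
      untilRuin M c x α ω ∩ Set.Iic (t : ℝ) = Set.Icc 0 (r : ℝ) := by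
  have hfin : min (t : ℝ≥0∞) (ruinTime M c x α ω) ≠ ∞ :=
    ne_top_of_le_ne_top ENNReal.coe_ne_top (min_le_left _ _)
  refine ⟨(min (t : ℝ≥0∞) (ruinTime M c x α ω)).toNNReal, ENNReal.coe_toNNReal hfin, ?_⟩
  ext s
  simp only [untilRuin, Set.mem_inter_iff, Set.mem_ofPred_eq, Set.mem_Iic, Set.mem_Icc, and_assoc,
    and_congr_right_iff]
  intro hs
  lift s to ℝ≥0 using hs
  rw [NNReal.coe_le_coe, NNReal.coe_le_coe, ← ENNReal.coe_le_coe (r := s) (q := ENNReal.toNNReal _),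
    ENNReal.coe_toNNReal hfin, le_min_iff, ENNReal.coe_le_coe, ENNReal.ofReal_coe_nnreal, and_comm]

lemma measurableSet_untilRuin : MeasurableSet (untilRuin M c x α ω) :=
  measurableSet_Ici.inter (measurableSet_le ENNReal.measurable_ofReal measurable_const)

/-- `∫_{[0, T]} e^{-ρ s} dZ_s` -/
noncomputable def discountedDividends (c ρ x : ℝ) (ω : Ω) : ℝ≥0∞ :=
  ∫⁻ s in untilRuin M c x α ω, ENNReal.ofReal (Real.exp (-ρ * s))
    ∂pathMeasure (fun t => α.Z t ω) (α.Z_mono ω) (α.Z_zero ω)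

/-- `∫_{[0, T]} e^{-ρ s} dK_s` -/
noncomputable def discountedInjections (c ρ x : ℝ) (ω : Ω) : ℝ≥0∞ :=
  ∫⁻ s in untilRuin M c x α ω, ENNReal.ofReal (Real.exp (-ρ * s))
    ∂pathMeasure (fun t => α.K t ω) (α.K_mono ω) (α.K_zero ω).ge

variable {ρ : ℝ}

/-- If, up to ruin, dividends plus `g` are at most injections plus `h`, then the same holds for
the discounted totals. -/
lemma discountedDividends_add_le (hρ : 0 < ρ) {g h : ℝ → ℝ≥0∞} (hg : Measurable g)
    (hh : Measurable h)
    (hle : ∀ t r : ℝ≥0, (r : ℝ≥0∞) = min (t : ℝ≥0∞) (ruinTime M c x α ω) →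
      ENNReal.ofReal (α.Z r ω) + g t ≤ ENNReal.ofReal (injected M α r ω) + h t) :
    discountedDividends M α c ρ x ω +
        ∫⁻ t in Set.Ioi (0 : ℝ), ENNReal.ofReal (ρ * Real.exp (-ρ * t)) * g t ≤
      discountedInjections M α c ρ x ω +
        ∫⁻ t in Set.Ioi (0 : ℝ), ENNReal.ofReal (ρ * Real.exp (-ρ * t)) * h t := by
  have hA0 : untilRuin M c x α ω ⊆ Set.Ici 0 := fun s hs => hs.1
  rw [discountedDividends, discountedInjections,
    lintegral_discount hρ _ (measurableSet_untilRuin M α) hA0,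
    lintegral_discount hρ _ (measurableSet_untilRuin M α) hA0,
    ← lintegral_add_right _ (by fun_prop), ← lintegral_add_right _ (by fun_prop)]
  refine setLIntegral_mono' measurableSet_Ioi fun t ht => ?_
  lift t to ℝ≥0 using (Set.mem_Ioi.mp ht).le
  obtain ⟨r, hr, hA⟩ := untilRuin_inter_Iic M (c := c) (x := x) α (ω := ω) t
  rw [hA, pathMeasure_Icc, pathMeasure_Icc, ← mul_add, ← mul_add,
    rightLim_extendPath_of_continuous (α.Z_mono ω) (α.Z_zero ω) (α.Z_rightCont ω r)]
  exact mul_le_mul' le_rfl (hle t r hr)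

lemma lintegral_discount_const (hρ : 0 < ρ) (C : ℝ≥0∞) :
    ∫⁻ t in Set.Ioi (0 : ℝ), ENNReal.ofReal (ρ * Real.exp (-ρ * t)) * C = C := by
  rw [lintegral_mul_const _ (by fun_prop), lintegral_exp_neg_Ioi hρ]
  simp

lemma injected_nonneg (r : ℝ≥0) : 0 ≤ injected M α r ω :=
  (α.K_zero ω).ge.trans ((α.K_mono ω (zero_le)).trans
    (le_rightLim_extendPath (α.K_mono ω) (α.K_zero ω).ge r))

lemma lintegral_discount_affine (hρ : 0 < ρ) {x c : ℝ} (hc : 0 ≤ c) :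
    ∫⁻ t in Set.Ioi (0 : ℝ), ENNReal.ofReal (ρ * Real.exp (-ρ * t)) *
      (ENNReal.ofReal x + ENNReal.ofReal c * ENNReal.ofReal t) =
    ENNReal.ofReal x + ENNReal.ofReal (c / ρ) := by
  simp only [mul_add]
  rw [lintegral_add_right _ (by fun_prop), lintegral_discount_const hρ]
  congr 1
  simp only [mul_left_comm _ (ENNReal.ofReal c)]
  rw [lintegral_const_mul _ (by fun_prop), lintegral_exp_neg_mul_id hρ, ← ENNReal.ofReal_mul hc,
    mul_one_div]

lemma dividends_le_of_le_ruinTime (hx : 0 ≤ x) (hα : IsAdmissible M c x α)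
    (hY : ∀ k, 0 ≤ M.Y k ω) {r : ℝ≥0} (hr : (r : ℝ≥0∞) ≤ ruinTime M c x α ω) :
    α.Z r ω ≤ x + c * r + injected M α r ω := by
  obtain ⟨n, -, hle⟩ := dividends_add_claims_le M α hx hα hr
  have := Finset.sum_nonneg fun k (_ : k ∈ Finset.range n) => hY k
  linarith

variable (hc : 0 ≤ c) (hx : 0 ≤ x) (hα : IsAdmissible M c x α)
  (hY : ∀ k, 0 ≤ M.Y k ω)
include hc hx hα hY

lemma discountedDividends_le (hρ : 0 < ρ) :
    discountedDividends M α c ρ x ω ≤ discountedInjections M α c ρ x ω +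
      (ENNReal.ofReal x + ENNReal.ofReal (c / ρ)) := by
  have h := discountedDividends_add_le M α (c := c) (x := x) (ω := ω) hρ (g := 0)
    (h := fun t => ENNReal.ofReal x + ENNReal.ofReal c * ENNReal.ofReal t) measurable_zero
    (by fun_prop) ?_
  · rw [lintegral_discount_affine hρ hc] at h
    simpa using h
  · intro t r hr
    have hrt : r ≤ t := ENNReal.coe_le_coe.mp (hr.trans_le (min_le_left _ _))
    have h1 := dividends_le_of_le_ruinTime M α hx hα hY (hr.trans_le (min_le_right _ _))
    have h2 : c * r ≤ c * t := by gcongr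
    rw [Pi.zero_apply, add_zero, ← ENNReal.ofReal_mul hc, ← ENNReal.ofReal_add hx (by positivity),
      ← ENNReal.ofReal_add (injected_nonneg M α r) (by positivity)]
    exact ENNReal.ofReal_le_ofReal (by linarith)

lemma discountedDividends_le_of_ruinTime_le (hρ : 0 < ρ) {ε : ℝ≥0}
    (hT : ruinTime M c x α ω ≤ ε) :
    discountedDividends M α c ρ x ω ≤ discountedInjections M α c ρ x ω +
      (ENNReal.ofReal x + ENNReal.ofReal (c * ε)) := by
  have h := discountedDividends_add_le M α (c := c) (x := x) (ω := ω) hρ (g := 0)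
    (h := fun _ => ENNReal.ofReal x + ENNReal.ofReal (c * ε)) measurable_zero measurable_const ?_
  · rw [lintegral_discount_const hρ] at h
    simpa using h
  · intro t r hr
    have hrt : r ≤ ε := ENNReal.coe_le_coe.mp (hr.trans_le ((min_le_right _ _).trans hT))
    have h1 := dividends_le_of_le_ruinTime M α hx hα hY (hr.trans_le (min_le_right _ _))
    have h2 : c * r ≤ c * ε := by gcongr
    rw [Pi.zero_apply, add_zero, ← ENNReal.ofReal_add hx (by positivity),
      ← ENNReal.ofReal_add (injected_nonneg M α r) (by positivity)]
    exact ENNReal.ofReal_le_ofReal (by linarith)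

lemma discountedDividends_le_of_lt_ruinTime (hρ : 0 < ρ) {ε : ℝ≥0}
    (hT : ε < ruinTime M c x α ω)
    (hS : c / ρ * Real.exp (ρ * ε) ≤ ∑ k ∈ Finset.range (M.N ε ω), M.Y k ω) :
    discountedDividends M α c ρ x ω ≤ discountedInjections M α c ρ x ω + ENNReal.ofReal x := by
  set S := ∑ k ∈ Finset.range (M.N ε ω), M.Y k ω with hSdef
  have hS0 : 0 ≤ S := Finset.sum_nonneg fun k _ => hY k
  have h := discountedDividends_add_le M α (c := c) (x := x) (ω := ω) hρ
    (g := (Set.Ioi (ε : ℝ)).indicator fun _ => ENNReal.ofReal S)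
    (h := fun t => ENNReal.ofReal x + ENNReal.ofReal c * ENNReal.ofReal t)
    (measurable_const.indicator measurableSet_Ioi) (by fun_prop) ?_
  · have hg : ∫⁻ t in Set.Ioi (0 : ℝ), ENNReal.ofReal (ρ * Real.exp (-ρ * t)) *
        (Set.Ioi (ε : ℝ)).indicator (fun _ => ENNReal.ofReal S) t =
        ENNReal.ofReal (Real.exp (-ρ * ε)) * ENNReal.ofReal S := by
      have hind : (fun t => ENNReal.ofReal (ρ * Real.exp (-ρ * t)) *
          (Set.Ioi (ε : ℝ)).indicator (fun _ => ENNReal.ofReal S) t) =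
          (Set.Ioi (ε : ℝ)).indicator fun t =>
            ENNReal.ofReal (ρ * Real.exp (-ρ * t)) * ENNReal.ofReal S :=
        funext fun t => (Set.indicator_mul_right _ (fun t => ENNReal.ofReal (ρ * Real.exp (-ρ * t)))
          fun _ => ENNReal.ofReal S).symm
      rw [hind, setLIntegral_indicator measurableSet_Ioi, Set.inter_eq_left.mpr
        (Set.Ioi_subset_Ioi ε.coe_nonneg), lintegral_mul_const _ (by fun_prop),
        lintegral_exp_neg_Ioi hρ]
    rw [lintegral_discount_affine hρ hc, hg] at h
    have hle : ENNReal.ofReal (c / ρ) ≤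
        ENNReal.ofReal (Real.exp (-ρ * ε)) * ENNReal.ofReal S := by
      rw [← ENNReal.ofReal_mul (Real.exp_nonneg _)]
      refine ENNReal.ofReal_le_ofReal ?_
      calc c / ρ = Real.exp (-ρ * ε) * (c / ρ * Real.exp (ρ * ε)) := by
            rw [mul_left_comm, ← Real.exp_add]; simp
        _ ≤ _ := by gcongr
    rw [← add_assoc] at h
    exact (ENNReal.add_le_add_iff_right ENNReal.ofReal_ne_top).mp
      ((add_le_add_right hle _).trans h)
  · intro t r hr
    have hrt : r ≤ t := ENNReal.coe_le_coe.mp (hr.trans_le (min_le_left _ _))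
    have h2 : c * r ≤ c * t := by gcongr
    obtain ⟨n, hn, h1⟩ := dividends_add_claims_le M α hx hα (hr.trans_le (min_le_right _ _))
    rw [← ENNReal.ofReal_mul hc, ← ENNReal.ofReal_add hx (by positivity),
      ← ENNReal.ofReal_add (injected_nonneg M α r) (by positivity)]
    have hZ : 0 ≤ α.Z r ω := (α.Z_zero ω).trans (α.Z_mono ω (zero_le))
    by_cases ht : (ε : ℝ) < t
    · have hεr : ε < r := by
        rw [← ENNReal.coe_lt_coe, hr, lt_min_iff]
        exact ⟨ENNReal.coe_lt_coe.mpr (NNReal.coe_lt_coe.mp ht), hT⟩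
      have hSn : S ≤ ∑ k ∈ Finset.range n, M.Y k ω :=
        Finset.sum_le_sum_of_subset_of_nonneg (Finset.range_subset_range.mpr (hn ε hεr))
          fun k _ _ => hY k
      rw [Set.indicator_of_mem (Set.mem_Ioi.mpr ht), ← ENNReal.ofReal_add hZ hS0]
      exact ENNReal.ofReal_le_ofReal (by linarith)
    · rw [Set.indicator_of_notMem (by simpa using ht), add_zero]
      have := Finset.sum_nonneg fun k (_ : k ∈ Finset.range n) => hY k
      exact ENNReal.ofReal_le_ofReal (by linarith)

lemma discountedDividends_le_add_indicator (hρ : 0 < ρ) (ε : ℝ≥0) :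
    discountedDividends M α c ρ x ω ≤ discountedInjections M α c ρ x ω +
      (ENNReal.ofReal x + ENNReal.ofReal (c * ε) +
        {ω | ∑ k ∈ Finset.range (M.N ε ω), M.Y k ω < c / ρ * Real.exp (ρ * ε)}.indicator
          (fun _ => ENNReal.ofReal (c / ρ)) ω) := by
  by_cases hS : ∑ k ∈ Finset.range (M.N ε ω), M.Y k ω < c / ρ * Real.exp (ρ * ε)
  · rw [Set.indicator_of_mem (by exact hS)]
    refine (discountedDividends_le M α hc hx hα hY hρ).trans ?_
    gcongr
    exact le_self_add
  · rw [Set.indicator_of_notMem (by exact hS), add_zero]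
    rcases le_or_gt (ruinTime M c x α ω) ε with hT | hT
    · exact discountedDividends_le_of_ruinTime_le M α hc hx hα hY hρ hT
    · refine (discountedDividends_le_of_lt_ruinTime M α hc hx hα hY hρ hT (not_lt.mp hS)).trans ?_
      gcongr
      exact le_self_add

end Pathwise

section ClaimCount

variable {Ω : Type*} [mΩ : MeasurableSpace Ω] {P : Measure Ω} {a b η : ℝ} {f : ℝ → ℝ} {y : ℝ}
  (M : HawkesClaims P a b η f y)

/-- The pairs `(s, ω)` such that at least `n` claims occurred strictly before time `s`. -/
def claimsBefore (n : ℕ) : Set (ℝ≥0 × Ω) :=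
  ⋃ i, Set.Ioi (TopologicalSpace.denseSeq ℝ≥0 i) ×ˢ
    {ω | n ≤ M.N (TopologicalSpace.denseSeq ℝ≥0 i) ω}

lemma measurableSet_claimsBefore (n : ℕ) :
    MeasurableSet[M.𝔽.predictable] (claimsBefore M n) := by
  refine MeasurableSet.iUnion fun i => measurableSet_predictable_Ioi_prod ?_
  exact M.N_adapted _ (measurableSet_Ici (a := n))

lemma mem_claimsBefore {n : ℕ} {s t : ℝ≥0} {ω : Ω} (hst : s < t) (hs : n ≤ M.N s ω) :
    (t, ω) ∈ claimsBefore M n := by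
  obtain ⟨_, ⟨i, rfl⟩, hi⟩ := (TopologicalSpace.denseRange_denseSeq ℝ≥0).exists_between hst
  exact Set.mem_iUnion.mpr ⟨i, hi.2, hs.trans (M.N_mono ω hi.1.le)⟩

lemma notMem_claimsBefore {n : ℕ} {t : ℝ≥0} {ω : Ω} (ht : M.N t ω < n) :
    (t, ω) ∉ claimsBefore M n := by
  simp only [claimsBefore, Set.mem_iUnion, not_exists]
  intro i hi
  have h1 := M.N_mono ω (Set.mem_Ioi.mp hi.1).le
  have h2 : n ≤ M.N (TopologicalSpace.denseSeq ℝ≥0 i) ω := hi.2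
  exact absurd (h2.trans h1) (not_le.mpr ht)

lemma claimTime_mem_claimsBefore {k n : ℕ} (hk : n ≤ k) {ω : Ω} (h : ∃ t, k < M.N t ω) :
    (claimTime M.N k ω, ω) ∈ claimsBefore M n := by
  set τ := claimTime M.N k ω with hτ
  have hgt : ∀ s, τ < s → k < M.N s ω := fun s hs => by
    obtain ⟨u, hu, hus⟩ := exists_lt_of_csInf_lt h hs
    exact lt_of_lt_of_le hu (M.N_mono ω hus.le)
  have hkτ : k < M.N τ ω := by
    have h1 := (M.N_rightCont ω τ).tendsto.mono_left
      (nhdsWithin_mono τ Set.Ioi_subset_Ici_self)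
    rw [nhds_discrete] at h1
    obtain ⟨s, hs1, hs2⟩ := ((tendsto_pure.mp h1).and self_mem_nhdsWithin).exists
    rw [← hs1]
    exact hgt s hs2
  have hτ0 : 0 < τ := by
    refine pos_iff_ne_zero.mpr fun h0 => ?_
    rw [h0, M.N_zero] at hkτ
    exact absurd hkτ (Nat.not_lt_zero _)
  obtain ⟨s, hs, hN⟩ := M.N_jump ω τ hτ0
  exact mem_claimsBefore M hs (by omega)

include M in
lemma isProbabilityMeasure_claimLaw [IsProbabilityMeasure P] :
    IsProbabilityMeasure (claimLaw f) := by
  rw [← M.Y_law 0]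
  exact Measure.isProbabilityMeasure_map (M.Y_measurable 0).aemeasurable

lemma min_le_lintegral_lam (ha : 0 < a) (hb : 0 ≤ b) (hη : 0 ≤ η) (ε : ℝ≥0)
    (ω : Ω) :
    ENNReal.ofReal (min (y / (2 * a)) (y / 2 * ε)) ≤
      ∫⁻ s in Set.Ioc (0 : ℝ) ε, ENNReal.ofReal (M.lam s.toNNReal ω) := by
  have hint : ∀ t : ℝ≥0, ENNReal.ofReal (∫ s in (0 : ℝ)..t, M.lam s.toNNReal ω) ≤
      ∫⁻ s in Set.Ioc (0 : ℝ) t, ENNReal.ofReal (M.lam s.toNNReal ω) := fun t => by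
    rw [intervalIntegral.integral_of_le t.coe_nonneg]
    have hi := (M.lam_intervalIntegrable ω t).1
    calc ENNReal.ofReal (∫ s in Set.Ioc (0 : ℝ) t, M.lam s.toNNReal ω)
        ≤ ENNReal.ofReal (∫ s in Set.Ioc (0 : ℝ) t, max (M.lam s.toNNReal ω) 0) :=
          ENNReal.ofReal_le_ofReal (integral_mono hi hi.pos_part fun s => le_max_left _ _)
      _ = ∫⁻ s in Set.Ioc (0 : ℝ) t, ENNReal.ofReal (max (M.lam s.toNNReal ω) 0) :=
          ofReal_integral_eq_lintegral_ofReal hi.pos_part (ae_of_all _ fun s => le_max_right _ _)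
      _ = _ := by simp [ENNReal.ofReal_max]
  have hlam : ∀ t : ℝ≥0, y ≤ M.lam t ω + a * ∫ s in (0 : ℝ)..t, M.lam s.toNNReal ω := fun t => by
    have h1 := M.lam_eq ω t
    rw [intervalIntegral.integral_const_mul, intervalIntegral.integral_sub
      intervalIntegrable_const (M.lam_intervalIntegrable ω t), intervalIntegral.integral_const,
      smul_eq_mul, sub_zero] at h1
    have h2 : 0 ≤ a * (t * b) := by positivity
    have h3 : 0 ≤ η * M.N t ω := by positivity
    linarith
  by_cases h : ∃ t ≤ ε, y / (2 * a) < ∫ s in (0 : ℝ)..t, M.lam s.toNNReal ω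
  · obtain ⟨t, ht, hlt⟩ := h
    calc _ ≤ ENNReal.ofReal (∫ s in (0 : ℝ)..t, M.lam s.toNNReal ω) :=
          ENNReal.ofReal_le_ofReal ((min_le_left _ _).trans hlt.le)
      _ ≤ _ := hint t
      _ ≤ _ := lintegral_mono_set (Set.Ioc_subset_Ioc_right (NNReal.coe_le_coe.mpr ht))
  · push Not at h
    calc _ ≤ ENNReal.ofReal (y / 2 * ε) := ENNReal.ofReal_le_ofReal (min_le_right _ _)
      _ = ∫⁻ s in Set.Ioc (0 : ℝ) ε, ENNReal.ofReal (y / 2) := by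
          rw [setLIntegral_const, Real.volume_Ioc, sub_zero, ENNReal.ofReal_mul' ε.coe_nonneg]
      _ ≤ _ := by
          refine setLIntegral_mono' measurableSet_Ioc fun s hs => ENNReal.ofReal_le_ofReal ?_
          have h1 := h s.toNNReal (Real.toNNReal_le_iff_le_coe.mpr hs.2)
          have h2 := hlam s.toNNReal
          have h3 : a * ∫ s in (0 : ℝ)..s.toNNReal, M.lam s.toNNReal ω ≤ a * (y / (2 * a)) := by
            gcongr
          have h4 : a * (y / (2 * a)) = y / 2 := by field_simp
          linarith

lemma measurableSet_N_lt (ε : ℝ≥0) (n : ℕ) : MeasurableSet {ω | M.N ε ω < n} :=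
  M.𝔽.le ε _ (M.N_adapted ε (measurableSet_Iio (a := n)))

/-- A high initial intensity makes it unlikely that few claims occur by a given time. -/
lemma measure_N_lt_mul_le [IsProbabilityMeasure P] (ha : 0 < a) (hb : 0 ≤ b) (hη : 0 ≤ η)
    (ε : ℝ≥0) (n : ℕ) :
    P {ω | M.N ε ω < n} * ENNReal.ofReal (min (y / (2 * a)) (y / 2 * ε)) ≤ n := by
  have := isProbabilityMeasure_claimLaw M
  set D : Set (ℝ≥0 × Ω) := (Set.Ioc 0 ε ×ˢ Set.univ) \ claimsBefore M n with hD
  have hDm : MeasurableSet[M.𝔽.predictable] D :=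
    MeasurableSet.diff (measurableSet_predictable_Ioc_prod 0 ε MeasurableSet.univ)
      (measurableSet_claimsBefore M n)
  let H : (ℝ≥0 × Ω) × ℝ → ℝ≥0∞ := fun p => D.indicator 1 p.1
  have hH : Measurable[MeasurableSpace.prod M.𝔽.predictable (borel ℝ)] H := by
    have h1 : Measurable[M.𝔽.predictable] (D.indicator (1 : ℝ≥0 × Ω → ℝ≥0∞)) :=
      Measurable.indicator measurable_const hDm
    exact @Measurable.comp _ _ _ (MeasurableSpace.prod M.𝔽.predictable (borel ℝ))
      M.𝔽.predictable _ _ _ h1 (@measurable_fst _ _ M.𝔽.predictable (borel ℝ))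
  have hint := M.intensity H hH
  have hleft : ∫⁻ ω, sumOverClaims M.N M.Y H ω ∂P ≤ n := by
    calc ∫⁻ ω, sumOverClaims M.N M.Y H ω ∂P ≤ ∫⁻ _, (n : ℝ≥0∞) ∂P := by
          refine lintegral_mono fun ω => ?_
          rw [sumOverClaims, tsum_eq_sum (s := Finset.range n)]
          · calc _ ≤ ∑ k ∈ Finset.range n, (1 : ℝ≥0∞) := by
                  refine Finset.sum_le_sum fun k _ => ?_
                  split_ifs
                  · exact Set.indicator_le_self' (by simp) _
                  · exact zero_le
              _ = n := by simp
          · intro k hk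
            split_ifs with h
            · refine Set.indicator_of_notMem (fun hmem => hmem.2 ?_) _
              exact claimTime_mem_claimsBefore M (by simpa using hk) h
            · rfl
      _ = n := by simp
  refine le_trans ?_ (hint.ge.trans hleft)
  rw [mul_comm, ← setLIntegral_const, ← lintegral_indicator (measurableSet_N_lt M ε n)]
  refine lintegral_mono fun ω => ?_
  by_cases hω : M.N ε ω < n
  · rw [Set.indicator_of_mem (by exact hω)]
    refine (min_le_lintegral_lam M ha hb hη ε ω).trans ?_
    refine le_trans (le_of_eq ?_) (lintegral_mono_set (Set.Ioc_subset_Ioi_self (a := (ε : ℝ))))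
    refine setLIntegral_congr_fun measurableSet_Ioc fun s hs => ?_
    have hmem : (s.toNNReal, ω) ∈ D := by
      have hsε : s.toNNReal ≤ ε := Real.toNNReal_le_iff_le_coe.mpr hs.2
      exact ⟨⟨⟨Real.toNNReal_pos.mpr hs.1, hsε⟩, trivial⟩,
        notMem_claimsBefore M ((M.N_mono ω hsε).trans_lt hω)⟩
    simp [H, hmem]
  · rw [Set.indicator_of_notMem (by exact hω)]
    exact zero_le

/-- The Laplace transform at `1` of the claim-size law. -/
noncomputable def claimLaplace (f : ℝ → ℝ) : ℝ := ∫ z, Real.exp (-z) ∂claimLaw f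

lemma mgf_claim (k : ℕ) : mgf (M.Y k) P (-1) = claimLaplace f := by
  rw [claimLaplace, ← M.Y_law k, integral_map (M.Y_measurable k).aemeasurable
    (by fun_prop : Continuous fun z : ℝ => Real.exp (-z)).aestronglyMeasurable]
  simp [mgf]

lemma claimLaplace_nonneg (f : ℝ → ℝ) : 0 ≤ claimLaplace f :=
  integral_nonneg fun _ => (Real.exp_pos _).le

lemma integrable_exp_neg_of_nonneg [IsFiniteMeasure P] {X : Ω → ℝ} (hX : Measurable X)
    (hX0 : ∀ᵐ ω ∂P, 0 ≤ X ω) : Integrable (fun ω => Real.exp (-1 * X ω)) P := by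
  refine Integrable.of_bound (by fun_prop) 1 ?_
  filter_upwards [hX0] with ω h
  rw [Real.norm_eq_abs, abs_of_pos (Real.exp_pos _), Real.exp_le_one_iff]
  linarith

include M in
lemma claimLaplace_lt_one [IsProbabilityMeasure P] : claimLaplace f < 1 := by
  rw [← mgf_claim M 0, mgf]
  have hi := integrable_exp_neg_of_nonneg (M.Y_measurable 0) ((M.Y_pos 0).mono fun _ h => h.le)
  have h1 : 0 < ∫ ω, (1 - Real.exp (-1 * M.Y 0 ω)) ∂P := by
    have hpos : ∀ᵐ ω ∂P, 0 < 1 - Real.exp (-1 * M.Y 0 ω) := by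
      filter_upwards [M.Y_pos 0] with ω h
      rw [sub_pos, Real.exp_lt_one_iff]
      linarith
    rw [integral_pos_iff_support_of_nonneg_ae (hpos.mono fun _ h => h.le)
      ((integrable_const 1).sub hi)]
    have : Function.support (fun ω => 1 - Real.exp (-1 * M.Y 0 ω)) =ᵐ[P] Set.univ :=
      eventuallyEq_univ.mpr (hpos.mono fun _ h => h.ne')
    rw [measure_congr this, measure_univ]
    exact one_pos
  rw [integral_sub (integrable_const 1) hi] at h1
  simpa using h1

lemma measure_sum_claims_le [IsProbabilityMeasure P] (L : ℝ) (n : ℕ) :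
    P {ω | ∑ k ∈ Finset.range n, M.Y k ω ≤ L} ≤
      ENNReal.ofReal (Real.exp L * claimLaplace f ^ n) := by
  have hY : ∀ᵐ ω ∂P, ∀ k, 0 < M.Y k ω := ae_all_iff.mpr M.Y_pos
  have hm : Measurable (∑ k ∈ Finset.range n, M.Y k) := by
    simpa only [← Finset.sum_apply] using
      Finset.measurable_sum (Finset.range n) fun k _ => M.Y_measurable k
  have h := measure_le_le_exp_mul_mgf (μ := P) (X := ∑ k ∈ Finset.range n, M.Y k) (t := -1) L
    (by norm_num) (integrable_exp_neg_of_nonneg hm (hY.mono fun ω h => by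
      rw [Finset.sum_apply]; exact Finset.sum_nonneg fun k _ => (h k).le))
  rw [M.Y_indep.mgf_sum M.Y_measurable, Finset.prod_congr rfl fun k _ => mgf_claim M k,
    Finset.prod_const, Finset.card_range] at h
  simp only [Finset.sum_apply, neg_neg, one_mul] at h
  rw [← ofReal_measureReal]
  exact ENNReal.ofReal_le_ofReal h

/-- The event that the total claim amount by time `ε` is less than `L`. -/
def smallLoss (ε : ℝ≥0) (L : ℝ) : Set Ω :=
  {ω | ∑ k ∈ Finset.range (M.N ε ω), M.Y k ω < L}

lemma measurableSet_smallLoss (ε : ℝ≥0) (L : ℝ) : MeasurableSet (smallLoss M ε L) :=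
  M.𝔽.le ε _ (M.claims_adapted ε (measurableSet_Iio (a := L)))

lemma measure_smallLoss_le [IsProbabilityMeasure P] (ha : 0 < a) (hb : 0 ≤ b) (hη : 0 ≤ η)
    (ε : ℝ≥0) (L : ℝ) (n : ℕ) {m : ℝ} (hm : 0 < m) (hmy : m ≤ min (y / (2 * a)) (y / 2 * ε)) :
    P (smallLoss M ε L) ≤ ENNReal.ofReal (n / m + Real.exp L * claimLaplace f ^ n) := by
  have hY : ∀ᵐ ω ∂P, ∀ k, 0 < M.Y k ω := ae_all_iff.mpr M.Y_pos
  have hsub : P (smallLoss M ε L) ≤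
      P ({ω | M.N ε ω < n} ∪ {ω | ∑ k ∈ Finset.range n, M.Y k ω ≤ L}) := by
    refine measure_mono_ae ?_
    filter_upwards [hY] with ω hω hS
    by_cases hN : M.N ε ω < n
    · exact Or.inl hN
    · refine Or.inr (le_trans ?_ (le_of_lt hS))
      exact Finset.sum_le_sum_of_subset_of_nonneg (Finset.range_subset_range.mpr (not_lt.mp hN))
        fun k _ _ => (hω k).le
  refine hsub.trans ((measure_union_le _ _).trans ?_)
  have hq := claimLaplace_nonneg f
  rw [ENNReal.ofReal_add (by positivity) (by positivity)]
  refine add_le_add ?_ (measure_sum_claims_le M L n)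
  rw [ENNReal.ofReal_div_of_pos hm, ENNReal.ofReal_natCast, ENNReal.le_div_iff_mul_le
    (Or.inl (ENNReal.ofReal_pos.mpr hm).ne') (Or.inl ENNReal.ofReal_ne_top)]
  exact (mul_le_mul' le_rfl (ENNReal.ofReal_le_ofReal hmy)).trans
    (measure_N_lt_mul_le M ha hb hη ε n)

end ClaimCount

lemma tendsto_measure_smallLoss {Ω : Type*} [MeasurableSpace Ω] {P : Measure Ω}
    [IsProbabilityMeasure P] {a b η : ℝ} (ha : 0 < a) (hb : 0 < b) (hη : 0 < η) {f : ℝ → ℝ}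
    (M : ∀ y : Set.Ici b, HawkesClaims P a b η f y) {ε : ℝ≥0} (hε : 0 < ε) (L : ℝ) :
    Tendsto (fun y => P (smallLoss (M y) ε L)) atTop (𝓝 0) := by
  rw [ENNReal.tendsto_nhds_zero]
  intro e he
  rcases eq_or_ne e ∞ with rfl | hetop
  · exact Eventually.of_forall fun _ => le_top
  lift e to ℝ≥0 using hetop
  have he' : (0 : ℝ) < e := by exact_mod_cast he
  have hpow : Tendsto (fun n => Real.exp L * claimLaplace f ^ n) atTop (𝓝 (Real.exp L * 0)) :=
    (tendsto_pow_atTop_nhds_zero_of_lt_one (claimLaplace_nonneg f)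
      (claimLaplace_lt_one (M ⟨b, Set.self_mem_Ici⟩))).const_mul _
  rw [mul_zero] at hpow
  obtain ⟨n, hn⟩ := (hpow.eventually_lt_const (half_pos he')).exists
  set m : ℝ := 2 * (n + 1) / e with hm
  have hmpos : 0 < m := by positivity
  have hmn : n / m ≤ e / 2 := by
    rw [hm, div_div_eq_mul_div, div_le_div_iff₀ (by positivity) two_pos]
    nlinarith
  have hε' : (0 : ℝ) < ε := hε
  filter_upwards [eventually_ge_atTop
    (⟨max b (max (m * (2 * a)) (2 * m / ε)), Set.mem_Ici.mpr (le_max_left _ _)⟩ : Set.Ici b)] with y hy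
  have hy' : max b (max (m * (2 * a)) (2 * m / ε)) ≤ (y : ℝ) := hy
  have h1 : m * (2 * a) ≤ y := (le_max_left _ _).trans ((le_max_right _ _).trans hy')
  have h2 : 2 * m / ε ≤ y := (le_max_right _ _).trans ((le_max_right _ _).trans hy')
  refine (measure_smallLoss_le (M y) ha hb.le hη.le ε L n hmpos (le_min ?_ ?_)).trans ?_
  · rwa [le_div_iff₀ (by positivity)]
  · rw [div_le_iff₀ hε'] at h2
    linarith
  · rw [← ENNReal.ofReal_coe_nnreal]
    exact ENNReal.ofReal_le_ofReal (by linarith)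

section Value

variable {Ω : Type*} [mΩ : MeasurableSpace Ω] {P : Measure Ω}
  {a b η : ℝ} {f : ℝ → ℝ} {y : ℝ} (M : HawkesClaims P a b η f y) {c ρ δ x : ℝ}

lemma reward_le_of_le {α : Strategy M.𝔽} (hδ : 1 ≤ δ) {r : ℝ≥0∞}
    (h : expectedDividends M c ρ x α ≤ expectedInjections M c ρ x α + r) :
    reward M c ρ δ x α ≤ r := by
  rw [reward]
  generalize expectedDividends M c ρ x α = D at h
  generalize expectedInjections M c ρ x α = I at h
  have hδ0 : (0 : EReal) < (δ : EReal) := by exact_mod_cast (zero_lt_one.trans_le hδ)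
  rcases eq_or_ne I ∞ with rfl | hI
  · rw [EReal.coe_ennreal_top, EReal.mul_top_of_pos hδ0]
    simp
  · lift I to ℝ≥0 using hI
    refine (EReal.sub_le_sub (EReal.coe_ennreal_le_coe_ennreal_iff.mpr h)
      (?_ : ((I : ℝ≥0∞) : EReal) ≤ _)).trans ?_
    · have h1 : (((I : ℝ≥0∞) : EReal)) = ((I : ℝ) : EReal) := rfl
      rw [h1, ← EReal.coe_mul, EReal.coe_le_coe_iff]
      exact le_mul_of_one_le_left I.coe_nonneg hδ
    · rw [EReal.coe_ennreal_add]
      have h1 : (((I : ℝ≥0∞) : EReal)) = ((I : ℝ) : EReal) := rfl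
      rw [h1, add_comm, EReal.add_sub_cancel_right]

/-- The strategy paying the whole initial surplus at time `0` and nothing afterwards. -/
def payInitialSurplus (𝔽 : Filtration ℝ≥0 mΩ) (hx : 0 ≤ x) : Strategy 𝔽 where
  Z _ _ := x
  K _ _ := 0
  Z_adapted _ := measurable_const
  Z_mono _ := monotone_const
  Z_rightCont _ _ := continuousWithinAt_const
  Z_zero _ := hx
  K_adapted _ := measurable_const
  K_mono _ := monotone_const
  K_leftCont _ _ := continuousWithinAt_const
  K_zero _ := rfl

lemma isAdmissible_payInitialSurplus (hx : 0 ≤ x) :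
    IsAdmissible M c x (payInitialSurplus M.𝔽 hx) := by
  refine fun ω => ⟨le_max_left _ _, fun t ht => ?_⟩
  have h : Function.leftLim (fun _ : ℝ≥0 => x) t = x :=
    have := nhdsLT_neBot_of_exists_lt ⟨0, ht⟩
    continuousWithinAt_const.leftLim_eq
  simp [payInitialSurplus, h]

variable [IsProbabilityMeasure P]

lemma expectedDividends_le (hc : 0 ≤ c) (hρ : 0 < ρ) (hx : 0 ≤ x) (α : Strategy M.𝔽)
    (hα : IsAdmissible M c x α) (ε : ℝ≥0) :
    expectedDividends M c ρ x α ≤ expectedInjections M c ρ x α +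
      (ENNReal.ofReal x + ENNReal.ofReal (c * ε) +
        ENNReal.ofReal (c / ρ) * P (smallLoss M ε (c / ρ * Real.exp (ρ * ε)))) := by
  have hS := measurableSet_smallLoss M ε (c / ρ * Real.exp (ρ * ε))
  have hY : ∀ᵐ ω ∂P, ∀ k, 0 < M.Y k ω := ae_all_iff.mpr M.Y_pos
  calc expectedDividends M c ρ x α
      ≤ ∫⁻ ω, (discountedInjections M α c ρ x ω +
          (ENNReal.ofReal x + ENNReal.ofReal (c * ε) +
            (smallLoss M ε (c / ρ * Real.exp (ρ * ε))).indicator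
              (fun _ => ENNReal.ofReal (c / ρ)) ω)) ∂P :=
        lintegral_mono_ae (hY.mono fun ω h =>
          discountedDividends_le_add_indicator M α hc hx hα (fun k => (h k).le) hρ ε)
    _ = _ := by
        have hm : Measurable fun ω => ENNReal.ofReal x + ENNReal.ofReal (c * ε) +
            (smallLoss M ε (c / ρ * Real.exp (ρ * ε))).indicator
              (fun _ => ENNReal.ofReal (c / ρ)) ω :=
          (measurable_const.indicator hS).const_add _
        rw [lintegral_add_right _ hm,
          lintegral_add_left measurable_const, lintegral_const, measure_univ, mul_one,
          lintegral_indicator_const hS]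
        rfl

lemma value_le (hc : 0 ≤ c) (hρ : 0 < ρ) (hδ : 1 ≤ δ) (hx : 0 ≤ x) (ε : ℝ≥0) :
    value M c ρ δ x ≤ ((ENNReal.ofReal x + ENNReal.ofReal (c * ε) +
      ENNReal.ofReal (c / ρ) * P (smallLoss M ε (c / ρ * Real.exp (ρ * ε))) : ℝ≥0∞) : EReal) :=
  iSup₂_le fun α hα => reward_le_of_le M hδ (expectedDividends_le M hc hρ hx α hα ε)

lemma le_value (hρ : 0 < ρ) (hx : 0 ≤ x) : (x : EReal) ≤ value M c ρ δ x := by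
  refine le_trans ?_ (le_iSup₂ (f := fun (α : Strategy M.𝔽) (_ : IsAdmissible M c x α) =>
    reward M c ρ δ x α) (payInitialSurplus M.𝔽 hx) (isAdmissible_payInitialSurplus M hx))
  set α := payInitialSurplus M.𝔽 hx with hα
  have hI : expectedInjections M c ρ x α = 0 := by
    refine (lintegral_congr fun ω => ?_).trans lintegral_zero
    rw [lintegral_discount hρ _ (measurableSet_untilRuin M α) fun s hs => hs.1]
    refine (setLIntegral_congr_fun measurableSet_Ioi fun t ht => ?_).trans lintegral_zero
    lift t to ℝ≥0 using (Set.mem_Ioi.mp ht).le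
    obtain ⟨r, -, hA⟩ := untilRuin_inter_Iic M (c := c) (x := x) α (ω := ω) t
    rw [hA, pathMeasure_Icc, rightLim_extendPath_of_continuous (α.K_mono ω) (α.K_zero ω).ge
      continuousWithinAt_const]
    simp [hα, payInitialSurplus]
  have hD : ENNReal.ofReal x ≤ expectedDividends M c ρ x α := by
    calc ENNReal.ofReal x = ∫⁻ _, ENNReal.ofReal x ∂P := by simp
      _ ≤ _ := by
        refine lintegral_mono fun ω => ?_
        have hsub : Set.Icc (0 : ℝ) 0 ⊆ untilRuin M c x α ω := by
          rw [Set.Icc_self, Set.singleton_subset_iff]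
          exact ⟨le_rfl, by simp⟩
        refine le_trans (le_of_eq ?_) (lintegral_mono_set hsub)
        have h1 := pathMeasure_Icc (α.Z_mono ω) (α.Z_zero ω) ((0 : ℝ≥0) : ℝ)
        rw [rightLim_extendPath_of_continuous (α.Z_mono ω) (α.Z_zero ω)
          continuousWithinAt_const] at h1
        rw [NNReal.coe_zero, Set.Icc_self] at h1
        rw [Set.Icc_self, lintegral_singleton, h1]
        simp [hα, payInitialSurplus]
  rw [reward, hI]
  simp only [EReal.coe_ennreal_zero, mul_zero, sub_zero]
  calc (x : EReal) = ((ENNReal.ofReal x : ℝ≥0∞) : EReal) := by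
        rw [EReal.coe_ennreal_ofReal, max_eq_left hx]
    _ ≤ _ := EReal.coe_ennreal_le_coe_ennreal_iff.mpr hD

end Value

end DividendHawkes

theorem mainTheorem7 {Ω : Type*} [MeasurableSpace Ω] (P : Measure Ω) [IsProbabilityMeasure P]
    (a b η c ρ δ : ℝ) (ha : 0 < a) (hb : 0 < b) (hη : 0 < η) (hc : 0 < c) (hρ : 0 < ρ)
    (hδ : 1 < δ) (f : ℝ → ℝ) (hf : Measurable f) (hf0 : ∀ z, 0 ≤ f z)
    (M : ∀ y : Set.Ici b, DividendHawkes.HawkesClaims P a b η f y)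
    (x : ℝ) (hx : 0 ≤ x) :
    Tendsto (fun y : Set.Ici b => DividendHawkes.value (M y) c ρ δ x) atTop (𝓝 (x : EReal)) := by
  have hxE : (x : EReal) = ((ENNReal.ofReal x : ℝ≥0∞) : EReal) := by
    rw [EReal.coe_ennreal_ofReal, max_eq_left hx]
  refine tendsto_order.mpr ⟨fun u hu => Eventually.of_forall fun y =>
    hu.trans_le (DividendHawkes.le_value (M y) hρ hx), fun u hu => ?_⟩
  have hε : Tendsto (fun ε : ℝ≥0 => ((ENNReal.ofReal x + ENNReal.ofReal (c * ε) : ℝ≥0∞) : EReal))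
      (𝓝[>] 0) (𝓝 (x : EReal)) := by
    have hcont : Continuous fun ε : ℝ≥0 =>
        ((ENNReal.ofReal x + ENNReal.ofReal (c * ε) : ℝ≥0∞) : EReal) :=
      continuous_coe_ennreal_ereal.comp
        (continuous_const.add (ENNReal.continuous_ofReal.comp (by fun_prop)))
    have h := hcont.tendsto 0
    simp only [NNReal.coe_zero, mul_zero, ENNReal.ofReal_zero, add_zero, ← hxE] at h
    exact h.mono_left nhdsWithin_le_nhds
  obtain ⟨ε, hεu, hεpos⟩ := ((hε.eventually_lt_const hu).and self_mem_nhdsWithin).exists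
  have hP := DividendHawkes.tendsto_measure_smallLoss ha hb hη M (Set.mem_Ioi.mp hεpos)
    (c / ρ * Real.exp (ρ * ε))
  have hlim : Tendsto (fun y : Set.Ici b => ((ENNReal.ofReal x + ENNReal.ofReal (c * ε) +
      ENNReal.ofReal (c / ρ) *
        P (DividendHawkes.smallLoss (M y) ε (c / ρ * Real.exp (ρ * ε))) : ℝ≥0∞) : EReal)) atTop
      (𝓝 ((ENNReal.ofReal x + ENNReal.ofReal (c * ε) : ℝ≥0∞) : EReal)) := by
    refine (continuous_coe_ennreal_ereal.tendsto _).comp ?_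
    have h := (ENNReal.Tendsto.const_mul hP (Or.inr ENNReal.ofReal_ne_top)
      (a := ENNReal.ofReal (c / ρ))).const_add (ENNReal.ofReal x + ENNReal.ofReal (c * ε))
    simpa using h
  filter_upwards [hlim.eventually_lt_const hεu] with y hy
  exact (DividendHawkes.value_le (M y) hc.le hρ hδ.le hx ε).trans_lt hy
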